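/- A cut-and-project scheme $(G,H,\mathcal L)$ consists of locally compact abelian (Hausdorff) groups $G,H$ and a discrete cocompact subgroup $\mathcal L\subseteq G\times H$ such that the coordinate projection $\pi^G$ is injective on $\mathcal L$ and $\pi^H(\mathcal L)$ is dense in $H$. For $W\subseteq H$ put $\Lambda_W=\pi^G(\mathcal L\cap(G\times W))$. A subset of $G$ is called - a *model set* if it equals $\Lambda_W$ for some cut-and-project scheme $(G,H,\mathcal L)$ and some relatively compact Borel set $W\subseteq H$ with non-empty interior, and a *regular model set* if moreover $W$ can be chosen such that $\partial W$ has zero Haar measure; - an *inter model set* if it lies between $\Lambda_{W^\circ}$ and $\Lambda_{\overline W}$ (with respect to inclusion) for some cut-and-project scheme $(G,H,\mathcal L)$ and some relatively compact Borel set $W\subseteq H$ with non-empty interior, and an *inter regular model set* if moreover $W$ can be chosen such that $\partial W$ has zero Haar measure; - an *almost model set* if it lies between $\Lambda_U$ and $\Lambda_W$ for some cut-and-project scheme $(G,H,\mathcal L)$, some non-empty open $U\subseteq H$ and some compact $W\supseteq U$, and an *almost regular model set* if moreover $U,W$ can be chosen such that $W\setminus U$ has zero Haar measure. A point set in $G$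 is a locally finite subset of $G$; it is identified with its Dirac comb $\sum_{x\in\Lambda}\delta_x$. The hull $\mathbb X(\Lambda)$ of a point set $\Lambda$ is the set of all point sets $\Gamma\subseteq G$ in the closure of $\{s+\Lambda : s\in G\}$ with respect to the vague topology. **Proposition.** Let $G$ be a locally compact abelian group, let $\Lambda\subseteq G$ be a point set and let $\Gamma\in\mathbb X(\Lambda)$. (a) If $\Lambda$ is a model set, then $\Gamma$ is a model set; if $\Lambda$ is a regular model set, then $\Gamma$ is a regular model set. (b) If $\Lambda$ is an inter model set, then $\Gamma$ is an inter model set; if $\Lambda$ is an inter regular model set, then $\Gamma$ is an inter regular model set. (c) If $\Lambda$ is an almost model set, then $\Gamma$ is an almost model set; if $\Lambda$ is an almost regular model set, then $\Gamma$ is an almost regular model set. -/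

import Mathlib

universe u

open Set Topology MeasureTheory

/-- A cut-and-project scheme `(G, H, 𝓛)` over the locally compact abelian group `G`: the internal
space `H` is a locally compact abelian (Hausdorff) group, carrying its Borel `σ`-algebra, and `𝓛` is
a discrete cocompact subgroup of `G × H` that projects injectively to `G` and densely to `H`. -/
structure CutAndProjectScheme (G : Type u) [AddCommGroup G] [TopologicalSpace G] where
  /-- the internal space -/
  H : Type u
  [instAddCommGroup : AddCommGroup H]
  [instTopologicalSpace : TopologicalSpace H]
  [instIsTopologicalAddGroup : IsTopologicalAddGroup H]
  [instLocallyCompactSpace : LocallyCompactSpace H]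
  [instT2Space : T2Space H]
  [instMeasurableSpace : MeasurableSpace H]
  [instBorelSpace : BorelSpace H]
  /-- the lattice -/
  lattice : AddSubgroup (G × H)
  discrete : DiscreteTopology lattice
  cocompact : CompactSpace ((G × H) ⧸ lattice)
  injOn_fst : InjOn Prod.fst (lattice : Set (G × H))
  dense_snd : Dense (Prod.snd '' (lattice : Set (G × H)))

namespace CutAndProjectScheme

attribute [instance] instAddCommGroup instTopologicalSpace instIsTopologicalAddGroup
  instLocallyCompactSpace instT2Space instMeasurableSpace instBorelSpace

variable {G : Type u} [AddCommGroup G] [TopologicalSpace G]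

/-- The projection set `Λ_W = π^G (𝓛 ∩ (G × W))`. -/
def projectionSet (S : CutAndProjectScheme G) (W : Set S.H) : Set G :=
  Prod.fst '' ((S.lattice : Set (G × S.H)) ∩ univ ×ˢ W)

/-- The windows of model sets: relatively compact Borel sets with non-empty interior. -/
structure IsModelWindow (S : CutAndProjectScheme G) (W : Set S.H) : Prop where
  isCompact_closure : IsCompact (closure W)
  measurableSet : MeasurableSet W
  nonempty_interior : (interior W).Nonempty

/-- The windows of regular model sets: the topological boundary is moreover a Haar null set. -/
structure IsRegularModelWindow (S : CutAndProjectScheme G) (W : Set S.H) : Prop extends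
    S.IsModelWindow W where
  haar_frontier : (Measure.addHaar : Measure S.H) (frontier W) = 0

end CutAndProjectScheme

section ModelSets

variable {G : Type u} [AddCommGroup G] [TopologicalSpace G]

/-- `Γ` is a model set (in some cut-and-project scheme over `G`). -/
def IsModelSet (Γ : Set G) : Prop :=
  ∃ (S : CutAndProjectScheme G) (W : Set S.H), S.IsModelWindow W ∧ Γ = S.projectionSet W

/-- `Γ` is a regular model set. -/
def IsRegularModelSet (Γ : Set G) : Prop :=
  ∃ (S : CutAndProjectScheme G) (W : Set S.H), S.IsRegularModelWindow W ∧ Γ = S.projectionSet W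

/-- `Γ` is an inter model set. -/
def IsInterModelSet (Γ : Set G) : Prop :=
  ∃ (S : CutAndProjectScheme G) (W : Set S.H), S.IsModelWindow W ∧
    S.projectionSet (interior W) ⊆ Γ ∧ Γ ⊆ S.projectionSet (closure W)

/-- `Γ` is an inter regular model set. -/
def IsInterRegularModelSet (Γ : Set G) : Prop :=
  ∃ (S : CutAndProjectScheme G) (W : Set S.H), S.IsRegularModelWindow W ∧
    S.projectionSet (interior W) ⊆ Γ ∧ Γ ⊆ S.projectionSet (closure W)

/-- `Γ` is an almost model set. -/
def IsAlmostModelSet (Γ : Set G) : Prop :=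
  ∃ (S : CutAndProjectScheme G) (U W : Set S.H), U ⊆ W ∧ IsOpen U ∧ U.Nonempty ∧ IsCompact W ∧
    S.projectionSet U ⊆ Γ ∧ Γ ⊆ S.projectionSet W

/-- `Γ` is an almost regular model set. -/
def IsAlmostRegularModelSet (Γ : Set G) : Prop :=
  ∃ (S : CutAndProjectScheme G) (U W : Set S.H), U ⊆ W ∧ IsOpen U ∧ U.Nonempty ∧ IsCompact W ∧
    (Measure.addHaar : Measure S.H) (W \ U) = 0 ∧
    S.projectionSet U ⊆ Γ ∧ Γ ⊆ S.projectionSet W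

end ModelSets

/-- A point set in `G`: a locally finite subset, so that its Dirac comb is a Radon measure. -/
structure PointSet (G : Type u) [TopologicalSpace G] where
  /-- the underlying set -/
  carrier : Set G
  locallyFinite : ∀ K : Set G, IsCompact K → (carrier ∩ K).Finite

namespace PointSet

variable {G : Type u} [TopologicalSpace G]

/-- The Dirac comb `∑_{x ∈ Λ} δ_x` of a point set, as a functional on `C_c(G)`; for each `f` only
finitely many summands are non-zero. -/
noncomputable def diracComb (Λ : PointSet G) (f : CompactlySupportedContinuousMap G ℝ) : ℝ :=
  ∑ᶠ x ∈ Λ.carrier, f x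

/-- The vague topology: the coarsest topology on point sets for which all evaluations
`Λ ↦ ∑_{x ∈ Λ} f x` with `f ∈ C_c(G)` are continuous. -/
noncomputable instance vagueTopology : TopologicalSpace (PointSet G) :=
  TopologicalSpace.induced diracComb Pi.topologicalSpace

/-- The translate `s + Λ`. -/
def translate [AddCommGroup G] [IsTopologicalAddGroup G] (s : G) (Λ : PointSet G) :
    PointSet G where
  carrier := (fun x => s + x) '' Λ.carrier
  locallyFinite K hK := by
    refine ((Λ.locallyFinite ((fun x => -s + x) '' K)
      (hK.image (continuous_const_add (-s)))).image (fun x => s + x)).subset ?_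
    rintro _ ⟨⟨x, hx, rfl⟩, hK⟩
    exact ⟨x, ⟨hx, s + x, hK, by simp⟩, rfl⟩

/-- The hull `𝕏(Λ)`: the closure of the translation orbit of `Λ` in the vague topology. -/
def hull [AddCommGroup G] [IsTopologicalAddGroup G] (Λ : PointSet G) : Set (PointSet G) :=
  closure (range fun s : G => translate s Λ)

end PointSet

/-! The model, inter model and almost model sets form the same class, and so do their regular
versions, so only almost model sets have to be followed into the hull.

For these the argument is compactness. If `s + Λ` tends to `Γ`, lattice vectors `l s` can be chosen
with `(s, 0) + l s` in a fixed compact set; along an ultrafilter these converge to some `(a, b)`,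
and `Γ` is caught between the projection sets of `U - b` and `W - b`, both translated by `a`
(`exists_translate_of_mem_hull`). The scheme `adjoin` absorbs the translation: it adds `a` to the
projected lattice and contains a copy of `H` as an open coset.

To turn an almost model set into a model set, the star map is paired with all rational characters of
the lattice, with values in a compact product of circles. This compact factor preserves the
cut-and-project axioms, and in it every subset of the lattice is cut out by a Borel set
(`exists_borel_preimage_circleEval_eq`), hence so is any set between two projection sets. The
boundary of the new window lies over `W \ U`, so null sets survive. -/

/-! ### Borel traces on abelian groups -/

/-- If the points of `L` admit a rank such that every point is isolated, in the topology induced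
from `K`, among the points of no larger rank, then every subset of `L` is the trace of a Borel
set. -/
theorem exists_borel_preimage_eq_of_rank {L K : Type*} [TopologicalSpace K] (ι : L → K)
    (r : L → ℕ) (h : ∀ x, ∃ O : Set K, IsOpen O ∧ ι x ∈ O ∧ ∀ y, ι y ∈ O → r y ≤ r x → y = x)
    (A : Set L) : ∃ B : Set K, MeasurableSet[borel K] B ∧ ι ⁻¹' B = A := by
  choose O hO hxO hiso using h
  borelize K
  -- Removing the neighbourhoods of rank above `n` leaves points of rank at most `n`; among those,
  -- `O x` with `r x = n` meets only `x`.
  refine ⟨⋃ n, (⋃ x ∈ {x | x ∈ A ∧ r x = n}, O x) \ ⋃ x ∈ {x | n < r x}, O x,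
    MeasurableSet.iUnion fun n => ?_, ?_⟩
  · exact (isOpen_biUnion fun x _ => hO x).measurableSet.diff
      (isOpen_biUnion fun x _ => hO x).measurableSet
  · ext y
    simp only [mem_preimage, mem_iUnion, mem_sdiff, mem_ofPred_eq, exists_prop, not_exists, not_and]
    constructor
    · rintro ⟨n, ⟨x, ⟨hxA, rfl⟩, hy⟩, hn⟩
      have hle : r y ≤ r x := not_lt.1 fun hlt => hn y hlt (hxO y)
      exact hiso x y hy hle ▸ hxA
    · intro hy
      refine ⟨r y, ⟨y, ⟨hy, rfl⟩, hxO y⟩, fun x hx hyx => ?_⟩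
      have := hiso x y hyx hx.le
      subst this
      exact lt_irrefl _ hx

/-- A set `E` in an abelian group is cyclically independent if the sum of the cyclic groups
generated by its elements is direct. -/
def CyclicallyIndependent {L : Type*} [AddCommGroup L] (E : Set L) : Prop :=
  ∀ n : L →₀ ℤ, (n.support : Set L) ⊆ E → (n.sum fun e k => k • e) = 0 → ∀ e, n e • e = 0

/-- Zorn applies because a relation involves finitely many elements, so over the union of a nonempty
chain it already lives in one member. -/
theorem exists_maximal_cyclicallyIndependent (L : Type*) [AddCommGroup L] :
    ∃ E : Set L, Maximal CyclicallyIndependent E := by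
  obtain ⟨E, hE⟩ := zorn_subset {E : Set L | CyclicallyIndependent E} (by
    intro c hc hchain
    rcases c.eq_empty_or_nonempty with rfl | hne
    · exact ⟨∅, fun n hn _ e => by
        have : n = 0 := by simpa [subset_empty_iff] using hn
        simp [this], by simp⟩
    refine ⟨⋃₀ c, fun n hn hsum => ?_, fun s hs => subset_sUnion_of_mem hs⟩
    obtain ⟨s, hs, hns⟩ := hchain.directedOn.exists_mem_subset_of_finset_subset_biUnion hne
      (s := n.support) (f := id) (by simpa [sUnion_eq_biUnion] using hn)
    exact hc hs n hns hsum)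
  exact ⟨E, hE⟩

/-- The subgroup generated by `E` is essential: for `x` outside `E`, maximality gives a nontrivial
relation on `insert x E`. Its `x`-term is nonzero, since otherwise the rest would be a nontrivial
relation in `E`. -/
theorem Maximal.exists_zsmul_mem_closure {L : Type*} [AddCommGroup L] {E : Set L}
    (hE : Maximal CyclicallyIndependent E) {x : L} (hx : x ≠ 0) :
    ∃ k : ℤ, k • x ≠ 0 ∧ k • x ∈ AddSubgroup.closure E := by
  classical
  by_cases hxE : x ∈ E
  · exact ⟨1, by simpa using hx, by simpa using AddSubgroup.subset_closure hxE⟩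
  have hnot : ¬ CyclicallyIndependent (insert x E) := fun h =>
    hxE (hE.le_of_ge h (subset_insert x E) (mem_insert x E))
  unfold CyclicallyIndependent at hnot
  push Not at hnot
  obtain ⟨n, hn, hsum, e, he⟩ := hnot
  have hsplit : n x • x + ((n.erase x).sum fun e k => k • e) = 0 := by
    by_cases hxs : x ∈ n.support
    · rw [← hsum]; exact Finsupp.add_sum_erase n x (fun e k => k • e) hxs
    · have h0 : n x = 0 := by simpa using hxs
      rw [Finsupp.erase_of_notMem_support hxs, hsum, h0]; simp
  have hsupp : ((n.erase x).support : Set L) ⊆ E := by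
    intro y hy
    simp only [Finsupp.support_erase, Finset.coe_erase, mem_sdiff, mem_singleton_iff] at hy
    exact (hn hy.1).resolve_left hy.2
  have hmem : ((n.erase x).sum fun e k => k • e) ∈ AddSubgroup.closure E :=
    AddSubgroup.sum_mem _ fun y hy =>
      AddSubgroup.zsmul_mem _ (AddSubgroup.subset_closure (hsupp hy)) _
  refine ⟨n x, fun h0 => ?_, ?_⟩
  · rw [h0, zero_add] at hsplit
    have := hE.prop _ hsupp hsplit e
    by_cases hex : e = x
    · exact he (hex ▸ h0)
    · rw [Finsupp.erase_ne hex] at this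
      exact he this
  · rw [eq_neg_of_add_eq_zero_left hsplit]
    exact neg_mem hmem

/-- A countable divisible group that contains cyclic groups of all orders. -/
abbrev CyclicHull : Type := ℚ × AddCircle (1 : ℚ)

noncomputable instance (E : Type*) : DivisibleBy (E →₀ CyclicHull) ℤ :=
  divisibleByOfSMulRightSurj _ _ fun {n} hn f => by
    -- The chosen quotient of `0` need not be `0`; forcing it keeps the support finite.
    refine ⟨f.mapRange (fun c => if c = 0 then 0 else DivisibleBy.div c n) (by simp), ?_⟩
    ext1 e
    simp only [Finsupp.smul_apply, Finsupp.mapRange_apply]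
    split_ifs with h
    · simp [h]
    · exact DivisibleBy.div_cancel _ hn

instance : Countable CyclicHull :=
  have : Countable (AddCircle (1 : ℚ)) :=
    (QuotientAddGroup.mk_surjective (s := AddSubgroup.zmultiples (1 : ℚ))).countable
  inferInstance

theorem CyclicHull.exists_addOrderOf_eq (n : ℕ) : ∃ c : CyclicHull, addOrderOf c = n := by
  rcases n.eq_zero_or_pos with rfl | hn
  · refine ⟨(1, 0), addOrderOf_eq_zero_iff'.2 fun n hn h => ?_⟩
    have := congrArg Prod.fst h
    simp at this
    omega
  · refine ⟨(0, ((1 / n : ℚ) : AddCircle (1 : ℚ))), ?_⟩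
    have : Fact ((0 : ℚ) < 1) := ⟨one_pos⟩
    have := AddCircle.addOrderOf_period_div (p := (1 : ℚ)) hn
    rw [Prod.addOrderOf_mk, this]
    simp

/-- The direct sum of cyclic groups generated by a maximal `E` embeds by sending each `e` to an
element of the same order. The target is divisible, so this extends to `L`, and the extension is
injective because the direct sum is essential. -/
theorem exists_injective_finsupp_cyclicHull (L : Type u) [AddCommGroup L] :
    ∃ (E : Type u) (f : L →+ (E →₀ CyclicHull)), Function.Injective f := by
  classical
  obtain ⟨E, hE⟩ := exists_maximal_cyclicallyIndependent L
  choose c hc using fun e : L => CyclicHull.exists_addOrderOf_eq (addOrderOf e)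
  have hiff : ∀ (k : ℤ) (e : L), k • c e = 0 ↔ k • e = 0 := fun k e => by
    rw [← addOrderOf_dvd_iff_zsmul_eq_zero, ← addOrderOf_dvd_iff_zsmul_eq_zero, hc]
  let p : (E →₀ ℤ) →+ L := Finsupp.liftAddHom fun e => (zmultiplesHom L) (e : L)
  let q : (E →₀ ℤ) →+ (E →₀ CyclicHull) :=
    Finsupp.liftAddHom fun e => (Finsupp.singleAddHom e).comp ((zmultiplesHom CyclicHull) (c e))
  have hq : ∀ n e, q n e = n e • c e := by
    intro n e
    induction n using Finsupp.induction_linear with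
    | zero => simp
    | add a b ha hb => simp [ha, hb, add_smul]
    | single a k =>
      by_cases h : a = e
      · subst h; simp [q]
      · simp [q, h]
  have hp : ∀ n, p n = 0 ↔ ∀ e, n e • (e : L) = 0 := by
    intro n
    constructor
    · intro h e
      have := hE.prop (n.mapDomain (↑)) (by
        intro y hy
        have := Finsupp.mapDomain_support hy
        simp only [Finset.mem_image] at this
        obtain ⟨a, -, rfl⟩ := this
        exact a.2) (by
          rw [Finsupp.sum_mapDomain_index (by simp) (by intros; simp [add_smul])]
          exact h) e
      rwa [Finsupp.mapDomain_apply Subtype.val_injective] at this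
    · intro h
      simp only [p, Finsupp.liftAddHom_apply]
      exact Finset.sum_eq_zero fun e _ => by simpa using h e
  have hker : ∀ n, p n = 0 ↔ q n = 0 := by
    intro n
    rw [hp, DFunLike.ext_iff]
    simp [hq, hiff]
  have hrange : AddSubgroup.closure E ≤ p.range := by
    rw [AddSubgroup.closure_le]
    intro e he
    exact ⟨Finsupp.single ⟨e, he⟩ 1, by simp [p]⟩
  let g : p.range →+ (E →₀ CyclicHull) :=
    (QuotientAddGroup.lift p.ker q fun n hn => (hker n).1 hn).comp
      (QuotientAddGroup.quotientKerEquivRange p).symm.toAddMonoidHom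
  have hg : ∀ n, g ⟨p n, n, rfl⟩ = q n := by
    intro n
    have : (QuotientAddGroup.quotientKerEquivRange p).symm ⟨p n, n, rfl⟩ = (n : _ ⧸ p.ker) := by
      rw [AddEquiv.symm_apply_eq]; rfl
    simp only [g, AddMonoidHom.comp_apply]
    erw [this]
    rfl
  obtain ⟨F, hF⟩ := (Module.Baer.of_divisible (E →₀ CyclicHull)).extension_property_addMonoidHom
    p.range.subtype (Subtype.val_injective) g
  refine ⟨E, F, (injective_iff_map_eq_zero F).2 fun x hx => ?_⟩
  by_contra hne
  obtain ⟨k, hk, hkE⟩ := hE.exists_zsmul_mem_closure hne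
  obtain ⟨n, hn⟩ := hrange hkE
  apply hk
  rw [← hn, hker, ← hg, ← DFunLike.congr_fun hF]
  simp [hn, hx]

/-- The canonical homomorphism from `ℚ / ℤ` to `ℝ / ℤ`. -/
noncomputable def ratCircleHom : AddCircle (1 : ℚ) →+ UnitAddCircle :=
  QuotientAddGroup.map _ _ (Rat.castHom ℝ).toAddMonoidHom (by
    rw [AddSubgroup.zmultiples_le]
    exact ⟨1, by simp⟩)

theorem ratCircleHom_injective : Function.Injective ratCircleHom := by
  refine (injective_iff_map_eq_zero _).2 fun x hx => ?_
  obtain ⟨q, rfl⟩ := QuotientAddGroup.mk_surjective x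
  have h : ((q : ℝ) : UnitAddCircle) = 0 := hx
  rw [AddCircle.coe_eq_zero_iff] at h
  obtain ⟨n, hn⟩ := h
  refine (AddCircle.coe_eq_zero_iff (1 : ℚ)).2 ⟨n, ?_⟩
  rw [zsmul_eq_mul, mul_one] at hn ⊢
  exact_mod_cast hn

/-- The evaluation homomorphism of an abelian group into a product of circles indexed by its
rational characters. -/
noncomputable def circleEval (L : Type u) [AddCommGroup L] :
    L →+ (CharacterModule L → UnitAddCircle) where
  toFun x χ := ratCircleHom (χ x)
  map_zero' := by ext χ; simp
  map_add' x y := by ext χ; simp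

/-- Every subset of an abelian group is the trace of a Borel set under the embedding into a
compact group given by all rational characters. -/
theorem exists_borel_preimage_circleEval_eq (L : Type u) [AddCommGroup L] (A : Set L) :
    ∃ B : Set (CharacterModule L → UnitAddCircle), MeasurableSet[borel _] B ∧
      circleEval L ⁻¹' B = A := by
  classical
  obtain ⟨E, f, hf⟩ := exists_injective_finsupp_cyclicHull L
  obtain ⟨enc, henc⟩ := exists_injective_nat CyclicHull
  let r : L → ℕ := fun x => ∑ e ∈ (f x).support, (1 + enc (f x e))
  refine exists_borel_preimage_eq_of_rank _ r (fun x => ?_) A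
  have hsep : ∀ c c' : CyclicHull, ∃ φ : CharacterModule CyclicHull, c ≠ c' → φ c ≠ φ c' := by
    intro c c'
    by_cases h : c = c'
    · exact ⟨0, fun h' => absurd h h'⟩
    · obtain ⟨φ, hφ⟩ := CharacterModule.exists_character_apply_ne_zero_of_ne_zero (sub_ne_zero.2 h)
      exact ⟨φ, fun _ h' => hφ (by rw [map_sub, h', sub_self])⟩
  choose φ hφ using hsep
  let χ : E → CyclicHull → CharacterModule L := fun e c =>
    AddMonoidHom.comp (φ (f x e) c) ((Finsupp.applyAddHom e).comp f)
  have hχ : ∀ e c y, χ e c y = φ (f x e) c (f y e) := fun _ _ _ => rfl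
  -- The finitely many values that a coordinate of a point of rank at most `r x` can take; `0`
  -- accounts for coordinates off the support.
  let F : Set CyclicHull := {c | enc c ≤ r x} ∪ {0}
  have hF : F.Finite := ((finite_Iic (r x)).preimage henc.injOn).union (finite_singleton 0)
  refine ⟨⋂ e ∈ (f x).support, ⋂ c ∈ F \ {f x e},
    {k | k (χ e c) ≠ ratCircleHom (φ (f x e) c c)}, ?_, ?_, ?_⟩
  · refine isOpen_biInter_finset fun e _ => hF.sdiff.isOpen_biInter fun c _ => ?_
    exact isOpen_ne.preimage (continuous_apply (χ e c))
  · simp only [mem_iInter]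
    intro e _ c hc h
    exact hφ (f x e) c (fun h' => hc.2 h'.symm) (ratCircleHom_injective h)
  · intro y hy hr
    simp only [mem_iInter] at hy
    have hle : ∀ e, f y e ∈ F := by
      intro e
      by_cases h : f y e = 0
      · exact Or.inr h
      · refine Or.inl (le_trans ?_ hr)
        have := Finset.single_le_sum (f := fun e => 1 + enc (f y e)) (fun _ _ => Nat.zero_le _)
          (Finsupp.mem_support_iff.2 h)
        change _ ≤ r y at this
        omega
    have heq : ∀ e ∈ (f x).support, f y e = f x e := by
      intro e he
      by_contra hne
      exact hy e he (f y e) ⟨hle e, hne⟩ rfl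
    have hsub : (f x).support ⊆ (f y).support := fun e he => by
      rw [Finsupp.mem_support_iff, heq e he]
      exact Finsupp.mem_support_iff.1 he
    -- Each support element beyond those of `x` costs at least `1`, thanks to the summand `1` in the
    -- rank, so `r y ≤ r x` excludes any.
    have hsum : r y = r x + ∑ e ∈ (f y).support \ (f x).support, (1 + enc (f y e)) := by
      simp only [r]
      rw [← Finset.sum_sdiff hsub, add_comm]
      congr 1
      exact Finset.sum_congr rfl fun e he => by rw [heq e he]
    have hsupp : (f y).support ⊆ (f x).support := by
      intro e he
      by_contra hne
      have := Finset.single_le_sum (f := fun e => 1 + enc (f y e)) (fun _ _ => Nat.zero_le _)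
          (Finset.mem_sdiff.2 ⟨he, hne⟩)
      omega
    apply hf
    ext1 e
    by_cases he : e ∈ (f x).support
    · exact heq e he
    · rw [Finsupp.notMem_support_iff.1 he, Finsupp.notMem_support_iff.1 fun h => he (hsupp h)]

/-! ### Vague convergence of point sets -/

section Vague

open Filter

variable {G : Type u} [TopologicalSpace G]

theorem exists_bump [LocallyCompactSpace G] [RegularSpace G] {x : G} {O : Set G} (hO : O ∈ 𝓝 x) :
    ∃ φ : CompactlySupportedContinuousMap G ℝ, (∀ y, 0 ≤ φ y) ∧ (∀ᶠ y in 𝓝 x, φ y = 1) ∧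
      ∀ y, φ y ≠ 0 → y ∈ O := by
  obtain ⟨k, hk, hkO, hkc⟩ := local_compact_nhds (interior_mem_nhds.2 hO)
  obtain ⟨f, hf1, hf0, hfc, hf⟩ := exists_continuous_one_zero_of_isCompact hkc
    (isOpen_interior (s := O)).isClosed_compl (disjoint_compl_right_iff_subset.2 hkO)
  refine ⟨⟨f, hfc⟩, fun y => (hf y).1, mem_of_superset hk hf1, fun y hy => ?_⟩
  by_contra hyO
  exact hy (hf0 fun h => hyO (interior_subset h))

namespace PointSet

theorem one_le_diracComb (Λ : PointSet G) {φ : CompactlySupportedContinuousMap G ℝ}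
    (hφ : ∀ y, 0 ≤ φ y) {x : G} (hx : x ∈ Λ.carrier) (hx1 : φ x = 1) : 1 ≤ Λ.diracComb φ := by
  have hfin : (Λ.carrier ∩ Function.support φ).Finite :=
    (Λ.locallyFinite _ φ.hasCompactSupport').subset
      (inter_subset_inter_right _ (subset_tsupport _))
  rw [diracComb, ← finsum_mem_inter_support, finsum_mem_eq_finite_toFinset_sum _ hfin, ← hx1]
  exact Finset.single_le_sum (fun y _ => hφ y) (by simp [hx, hx1])

theorem tendsto_diracComb {ι : Type*} {F : Filter ι} {Λ : ι → PointSet G} {Γ : PointSet G}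
    (h : Tendsto Λ F (𝓝 Γ)) (φ : CompactlySupportedContinuousMap G ℝ) :
    Tendsto (fun i => (Λ i).diracComb φ) F (𝓝 (Γ.diracComb φ)) :=
  (((continuous_apply φ).comp continuous_induced_dom).tendsto Γ).comp h

variable [LocallyCompactSpace G] [T2Space G]

theorem eventually_exists_mem_of_tendsto {ι : Type*} {F : Filter ι} {Λ : ι → PointSet G}
    {Γ : PointSet G} (h : Tendsto Λ F (𝓝 Γ)) {x : G} (hx : x ∈ Γ.carrier) {N : Set G}
    (hN : N ∈ 𝓝 x) : ∀ᶠ i in F, ∃ y ∈ (Λ i).carrier, y ∈ N := by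
  obtain ⟨φ, hφ, hφ1, hφN⟩ := exists_bump hN
  have hpos : 0 < Γ.diracComb φ := one_pos.trans_le (Γ.one_le_diracComb hφ hx hφ1.self_of_nhds)
  filter_upwards [(tendsto_diracComb h φ).eventually (lt_mem_nhds hpos)] with i hi
  obtain ⟨y, hy, hne⟩ := exists_ne_zero_of_finsum_mem_ne_zero hi.ne'
  exact ⟨y, hy, hφN y hne⟩

/-- If `x` were not in `Γ`, local finiteness would give a bump at `x` vanishing on `Γ`. Being `1` on
a whole neighbourhood of `x`, it has mass at least `1` on the approximating sets, a contradiction in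
the limit. -/
theorem mem_of_tendsto {ι : Type*} {F : Filter ι} [F.NeBot] {Λ : ι → PointSet G}
    {Γ : PointSet G} (h : Tendsto Λ F (𝓝 Γ)) {x : G} {y : ι → G} (hy : Tendsto y F (𝓝 x))
    (hmem : ∀ᶠ i in F, y i ∈ (Λ i).carrier) : x ∈ Γ.carrier := by
  by_contra hx
  obtain ⟨k, hkc, hk⟩ := exists_compact_mem_nhds x
  have hO : k ∩ (Γ.carrier ∩ k)ᶜ ∈ 𝓝 x :=
    inter_mem hk ((Γ.locallyFinite k hkc).isClosed.isOpen_compl.mem_nhds fun h => hx h.1)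
  obtain ⟨φ, hφ, hφ1, hφN⟩ := exists_bump hO
  have h0 : Γ.diracComb φ = 0 := by
    refine finsum_mem_eq_zero_of_forall_eq_zero fun z hz => ?_
    by_contra hne
    exact (hφN z hne).2 ⟨hz, (hφN z hne).1⟩
  have h1 : (1 : ℝ) ≤ Γ.diracComb φ := by
    refine ge_of_tendsto (tendsto_diracComb h φ) ?_
    filter_upwards [hmem, hy.eventually hφ1] with i hi hi1
    exact (Λ i).one_le_diracComb hφ hi hi1
  linarith

end PointSet

end Vague

/-! ### Lattices and limits of translates -/

theorem exists_isCompact_forall_exists_add_mem {X : Type*} [AddCommGroup X] [TopologicalSpace X]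
    [IsTopologicalAddGroup X] [LocallyCompactSpace X] (N : AddSubgroup X) [CompactSpace (X ⧸ N)] :
    ∃ C : Set X, IsCompact C ∧ ∀ x, ∃ l ∈ N, x + l ∈ C := by
  choose k hkc hk using fun x : X => exists_compact_mem_nhds x
  obtain ⟨t, -, ht⟩ := (isCompact_univ (X := X ⧸ N)).elim_nhds_subcover
    (fun q => QuotientAddGroup.mk '' k q.out) (fun q _ => by
      have := QuotientAddGroup.isOpenQuotientMap_mk.isOpenMap.image_mem_nhds (hk q.out)
        (f := (QuotientAddGroup.mk : X → X ⧸ N))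
      rwa [QuotientAddGroup.out_eq'] at this)
  refine ⟨⋃ q ∈ t, k q.out, t.isCompact_biUnion fun q _ => hkc _, fun x => ?_⟩
  obtain ⟨q, hq, y, hy, hyx⟩ := by simpa using ht (mem_univ (x : X ⧸ N))
  rw [QuotientAddGroup.eq_iff_sub_mem] at hyx
  exact ⟨y - x, hyx, by simpa using ⟨q, hq, hy⟩⟩

namespace CutAndProjectScheme

variable {G : Type u} [AddCommGroup G] [TopologicalSpace G]

theorem mem_projectionSet {S : CutAndProjectScheme G} {W : Set S.H} {x : G} :
    x ∈ S.projectionSet W ↔ ∃ h ∈ W, (x, h) ∈ S.lattice := by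
  constructor
  · rintro ⟨⟨x, h⟩, ⟨hl, -, hW⟩, rfl⟩
    exact ⟨h, hW, hl⟩
  · rintro ⟨h, hW, hl⟩
    exact ⟨(x, h), ⟨hl, mem_univ _, hW⟩, rfl⟩

theorem projectionSet_mono (S : CutAndProjectScheme G) {V W : Set S.H} (h : V ⊆ W) :
    S.projectionSet V ⊆ S.projectionSet W :=
  image_mono (inter_subset_inter_right _ (prod_mono_right h))

variable [IsTopologicalAddGroup G] [T2Space G]

theorem finite_lattice_inter (S : CutAndProjectScheme G) {C : Set (G × S.H)} (hC : IsCompact C) :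
    ((S.lattice : Set (G × S.H)) ∩ C).Finite := by
  have := S.discrete
  have h := S.lattice.tendsto_coe_cofinite_of_discrete
    (isDiscrete_iff_discreteTopology.2 S.discrete) hC.compl_mem_cocompact
  rw [Filter.mem_map, Filter.mem_cofinite] at h
  refine (h.image Subtype.val).subset ?_
  rintro x ⟨hx, hxC⟩
  exact ⟨⟨x, hx⟩, by simpa using hxC, rfl⟩

open Filter in
/-- An element of the hull of a point set between two projection sets lies, after translation,
between the projection sets of translated windows. -/
theorem exists_translate_of_mem_hull [LocallyCompactSpace G] (S : CutAndProjectScheme G) {U W : Set S.H} (hU : IsOpen U)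
    (hW : IsCompact W) {Λ Γ : PointSet G} (hUΛ : S.projectionSet U ⊆ Λ.carrier)
    (hΛW : Λ.carrier ⊆ S.projectionSet W) (hΓ : Γ ∈ Λ.hull) :
    ∃ (a : G) (b : S.H),
      (a + ·) '' S.projectionSet ((· + b) ⁻¹' U) ⊆ Γ.carrier ∧
      Γ.carrier ⊆ (a + ·) '' S.projectionSet ((· + b) ⁻¹' W) := by
  have := S.cocompact
  obtain ⟨C, hC, hCl⟩ := exists_isCompact_forall_exists_add_mem S.lattice
  choose l hl hlC using fun s : G => hCl (s, 0)
  let T : G → PointSet G := fun s => PointSet.translate s Λ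
  have hne : (comap T (𝓝 Γ)).NeBot := by
    rw [comap_neBot_iff]
    intro t ht
    obtain ⟨_, hx, s, rfl⟩ := mem_closure_iff_nhds.1 hΓ t ht
    exact ⟨s, hx⟩
  -- An ultrafilter replaces the passage to a convergent subnet.
  let F := Ultrafilter.of (comap T (𝓝 Γ))
  have hT : Tendsto T F (𝓝 Γ) := tendsto_comap.mono_left (Ultrafilter.of_le _)
  obtain ⟨⟨a, b⟩, -, hab⟩ := hC.ultrafilter_le_nhds (F.map fun s => (s, 0) + l s)
    (le_principal_iff.2 (mem_map.2 (Filter.univ_mem' hlC)))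
  have hlim : Tendsto (fun s => ((s, 0) : G × S.H) + l s) F (𝓝 (a, b)) := hab
  have hlim1 : Tendsto (fun s => s + (l s).1) F (𝓝 a) := (continuous_fst.tendsto _).comp hlim
  have hlim2 : Tendsto (fun s => (l s).2) F (𝓝 b) := by
    refine ((continuous_snd.tendsto _).comp hlim).congr fun s => ?_
    simp
  refine ⟨a, b, ?_, fun x hx => ?_⟩
  · rintro _ ⟨y, hy, rfl⟩
    obtain ⟨h, hhU, hyl⟩ := mem_projectionSet.1 hy
    refine PointSet.mem_of_tendsto hT (hlim1.add_const y) ?_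
    filter_upwards [(hlim2.const_add h).eventually (hU.mem_nhds hhU)] with s hs
    refine ⟨y + (l s).1, hUΛ (mem_projectionSet.2 ⟨h + (l s).2, hs, ?_⟩), by
      simp only; abel⟩
    exact S.lattice.add_mem hyl (hl s)
  · by_contra hcon
    obtain ⟨N, hNc, hN⟩ := exists_compact_mem_nhds x
    -- A point `s + v` in `N` with `(v, h)` in the lattice and `h ∈ W` gives the lattice point `(v,
    -- h) - l s` in this compact set, so only finitely many candidates occur, independently of `s`.
    have hfin := S.finite_lattice_inter
      ((((hNc.prod (hC.image continuous_fst)).image continuous_sub).prod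
        ((hW.prod (hC.image continuous_snd)).image continuous_sub)))
    set Y := (S.lattice : Set (G × S.H)) ∩ _ with hY
    have hbad : ∀ y ∈ Y, ∃ M ∈ 𝓝 x, ∀ᶠ s in (F : Filter G),
        ¬ (y.1 + (s + (l s).1) ∈ M ∧ y.2 + (l s).2 ∈ W) := by
      intro y hy
      -- A candidate fails in the limit in one of two ways: its internal coordinate stays off `W`,
      -- or its physical one stays away from `x`.
      by_cases h1 : y.1 + a = x
      · have h2 : y.2 + b ∉ W := fun h2 => hcon
          ⟨y.1, mem_projectionSet.2 ⟨y.2, h2, hy.1⟩, by simpa [add_comm] using h1⟩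
        refine ⟨univ, univ_mem, ?_⟩
        filter_upwards [(hlim2.const_add y.2).eventually
          (hW.isClosed.isOpen_compl.mem_nhds h2)] with s hs h
        exact hs h.2
      · obtain ⟨P, Q, hP, hQ, hPQ⟩ := t2_separation_nhds h1
        refine ⟨Q, hQ, ?_⟩
        filter_upwards [(hlim1.const_add y.1).eventually hP] with s hs h
        exact hPQ.notMem_of_mem_left hs h.1
    choose! M hM hMev using hbad
    have hNM : N ∩ ⋂ y ∈ Y, M y ∈ 𝓝 x := inter_mem hN ((biInter_mem hfin).2 hM)
    have hev := (eventually_all_finite hfin).2 hMev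
    obtain ⟨s, hs, z, hz, hzN⟩ :=
      (hev.and (PointSet.eventually_exists_mem_of_tendsto hT hx hNM)).exists
    obtain ⟨v, hv, rfl⟩ := hz
    obtain ⟨h, hhW, hvl⟩ := mem_projectionSet.1 (hΛW hv)
    have hyY : (v, h) - l s ∈ Y := by
      refine ⟨S.lattice.sub_mem hvl (hl s), ⟨(s + v, s + (l s).1), ⟨hzN.1, _, hlC s, rfl⟩, ?_⟩,
        ⟨(h, (l s).2), ⟨hhW, _, hlC s, by simp⟩, rfl⟩⟩
      simp
    refine hs _ hyY ⟨?_, by simpa using hhW⟩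
    have := mem_iInter₂.1 hzN.2 _ hyY
    convert this using 1
    simp only [Prod.fst_sub]
    abel

end CutAndProjectScheme

/-! ### Adjoining an element to the projected lattice -/

namespace CutAndProjectScheme

variable {G : Type u} [AddCommGroup G] [TopologicalSpace G]

theorem eq_zero_of_zero_mk_mem (S : CutAndProjectScheme G) {h : S.H}
    (hh : ((0, h) : G × S.H) ∈ S.lattice) : h = 0 :=
  congrArg Prod.snd (S.injOn_fst hh S.lattice.zero_mem rfl)

/-- The relations `(h, n)` with `(-n a, h)` in the lattice, which have to be divided out of
`H × ℤ` in order to adjoin `a` to the projected lattice. -/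
def adjoinRelations (S : CutAndProjectScheme G) (a : G) : AddSubgroup (S.H × ℤ) :=
  S.lattice.comap (((zmultiplesHom G (-a)).comp (AddMonoidHom.snd S.H ℤ)).prod
    (AddMonoidHom.fst S.H ℤ))

theorem mem_adjoinRelations {S : CutAndProjectScheme G} {a : G} {h : S.H} {n : ℤ} :
    (h, n) ∈ S.adjoinRelations a ↔ (-(n • a), h) ∈ S.lattice := by
  simp [adjoinRelations]

/-- The subgroup generated by the lattice and an element of the form `(a, ·)` in the extended
internal space. -/
def adjoinLattice (S : CutAndProjectScheme G) (a : G) :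
    AddSubgroup (G × (S.H × ℤ) ⧸ S.adjoinRelations a) :=
  AddSubgroup.map
    (((AddMonoidHom.fst G S.H).comp (AddMonoidHom.fst (G × S.H) ℤ) +
      (zmultiplesHom G a).comp (AddMonoidHom.snd (G × S.H) ℤ)).prod
      ((QuotientAddGroup.mk' (S.adjoinRelations a)).comp
        ((AddMonoidHom.snd G S.H).prodMap (AddMonoidHom.id ℤ))))
    (S.lattice.prod ⊤)

theorem mk_mem_adjoinLattice {S : CutAndProjectScheme G} {a x : G} {h : S.H} {n : ℤ} :
    ((x, ((h, n) : S.H × ℤ)) : G × (S.H × ℤ) ⧸ S.adjoinRelations a) ∈ S.adjoinLattice a ↔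
      (x - n • a, h) ∈ S.lattice := by
  constructor
  · rintro ⟨⟨⟨g, h'⟩, m⟩, ⟨hl, -⟩, heq⟩
    have h1 : g + m • a = x := congrArg Prod.fst heq
    have h2 : (((h', m) : S.H × ℤ) : (S.H × ℤ) ⧸ S.adjoinRelations a) = ((h, n) : S.H × ℤ) :=
      congrArg Prod.snd heq
    rw [QuotientAddGroup.eq_iff_sub_mem, Prod.mk_sub_mk, mem_adjoinRelations] at h2
    convert S.lattice.sub_mem hl h2 using 1
    ext
    · simp [← h1, sub_smul]; abel
    · simp
  · intro hl
    exact ⟨((x - n • a, h), n), ⟨hl, mem_univ _⟩, by simp⟩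

theorem isOpenMap_mk_adjoin (S : CutAndProjectScheme G) (a : G) (n : ℤ) :
    IsOpenMap fun h : S.H => (((h, n) : S.H × ℤ) : (S.H × ℤ) ⧸ S.adjoinRelations a) := by
  refine QuotientAddGroup.isOpenQuotientMap_mk.isOpenMap.comp fun U hU => ?_
  have : (fun h : S.H => (h, n)) '' U = U ×ˢ {n} := by ext ⟨h, m⟩; simp [eq_comm]
  rw [this]
  exact hU.prod (isOpen_discrete _)

theorem continuous_mk_adjoin (S : CutAndProjectScheme G) (a : G) (n : ℤ) :
    Continuous fun h : S.H => (((h, n) : S.H × ℤ) : (S.H × ℤ) ⧸ S.adjoinRelations a) :=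
  QuotientAddGroup.continuous_mk.comp (by fun_prop)

theorem injective_mk_adjoin (S : CutAndProjectScheme G) (a : G) (n : ℤ) :
    Function.Injective
      fun h : S.H => (((h, n) : S.H × ℤ) : (S.H × ℤ) ⧸ S.adjoinRelations a) := by
  intro h h' heq
  simp only [QuotientAddGroup.eq_iff_sub_mem, Prod.mk_sub_mk, mem_adjoinRelations, sub_self,
    zero_smul, neg_zero] at heq
  exact sub_eq_zero.1 (S.eq_zero_of_zero_mk_mem heq)

theorem exists_nhds_forall_lattice (S : CutAndProjectScheme G) :
    ∃ U ∈ 𝓝 (0 : G), ∃ V ∈ 𝓝 (0 : S.H), ∀ x h, (x, h) ∈ S.lattice → x ∈ U → h ∈ V →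
      x = 0 ∧ h = 0 := by
  have := S.discrete
  have h0 : ({0} : Set S.lattice) ∈ 𝓝 (0 : S.lattice) := by simp
  rw [nhds_subtype_eq_comap, Filter.mem_comap] at h0
  obtain ⟨O, hO, hOs⟩ := h0
  obtain ⟨U, hU, V, hV, hUV⟩ := mem_nhds_prod_iff.1 hO
  refine ⟨U, hU, V, hV, fun x h hl hx hh => ?_⟩
  have : (⟨(x, h), hl⟩ : S.lattice) = 0 := hOs (hUV ⟨hx, hh⟩ : (x, h) ∈ O)
  exact Prod.mk_eq_zero.1 (congrArg Subtype.val this)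

variable [IsTopologicalAddGroup G] [T2Space G]

theorem isClosed_lattice (S : CutAndProjectScheme G) :
    IsClosed (S.lattice : Set (G × S.H)) :=
  have := S.discrete
  AddSubgroup.isClosed_of_discrete

/-- Closedness makes the extended internal space Hausdorff. -/
theorem isClosed_adjoinRelations (S : CutAndProjectScheme G) (a : G) :
    IsClosed (S.adjoinRelations a : Set (S.H × ℤ)) := by
  refine S.isClosed_lattice.preimage (f := fun p : S.H × ℤ => (p.2 • (-a), p.1)) ?_
  exact ((continuous_of_discreteTopology (f := fun n : ℤ => n • (-a))).comp
    continuous_snd).prodMk continuous_fst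

/-- A discreteness criterion for subgroups. -/
theorem discreteTopology_addSubgroup_of_nhds {X : Type*} [AddCommGroup X] [TopologicalSpace X]
    [IsTopologicalAddGroup X] {N : AddSubgroup X} {O : Set X} (hO : O ∈ 𝓝 (0 : X))
    (h : ∀ x ∈ N, x ∈ O → x = 0) : DiscreteTopology N := by
  refine discreteTopology_of_isOpen_singleton_zero (isOpen_singleton_iff_nhds_eq_pure _ |>.2 ?_)
  refine le_antisymm (Filter.le_pure_iff.2 ?_) (pure_le_nhds _)
  refine Filter.mem_of_superset (continuous_subtype_val.continuousAt.preimage_mem_nhds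
    (x := (0 : N)) hO) fun x hx => ?_
  exact Subtype.ext (h x x.2 hx)

/-- The cut-and-project scheme obtained by adjoining `a` to the projected lattice. -/
def adjoin (S : CutAndProjectScheme G) (a : G) : CutAndProjectScheme G :=
  letI : IsClosed (S.adjoinRelations a : Set (S.H × ℤ)) := S.isClosed_adjoinRelations a
  { H := (S.H × ℤ) ⧸ S.adjoinRelations a
    instMeasurableSpace := borel _
    instBorelSpace := @BorelSpace.mk _ _ (borel _) rfl
    lattice := S.adjoinLattice a
    discrete := by
      obtain ⟨U, hU, V, hV, hUV⟩ := S.exists_nhds_forall_lattice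
      -- The image of `H × {0}` is open, and over it the new lattice is the old one.
      refine discreteTopology_addSubgroup_of_nhds
        (prod_mem_nhds hU ((S.isOpenMap_mk_adjoin a 0).image_mem_nhds hV)) ?_
      rintro ⟨x, _⟩ hl ⟨hx, h, hh, rfl⟩
      rw [mk_mem_adjoinLattice, zero_smul, sub_zero] at hl
      obtain ⟨rfl, rfl⟩ := hUV x h hl hx hh
      rfl
    cocompact := by
      have := S.cocompact
      let f : G × S.H →+ G × (S.H × ℤ) ⧸ S.adjoinRelations a :=
        (AddMonoidHom.id G).prodMap ((QuotientAddGroup.mk' _).comp (AddMonoidHom.inl S.H ℤ))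
      have hf : ∀ p, f p = (p.1, (((p.2, 0) : S.H × ℤ) : (S.H × ℤ) ⧸ S.adjoinRelations a)) :=
        fun _ => rfl
      have hle : S.lattice ≤ (S.adjoinLattice a).comap f := by
        rintro ⟨x, h⟩ hl
        rw [AddSubgroup.mem_comap, hf, mk_mem_adjoinLattice]
        simpa using hl
      have hcont : Continuous (QuotientAddGroup.map _ _ f hle) :=
        (QuotientAddGroup.continuous_mk.comp
          (continuous_fst.prodMk ((S.continuous_mk_adjoin a 0).comp continuous_snd))).quotient_lift _
      refine Function.Surjective.compactSpace hcont ?_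
      intro q
      obtain ⟨⟨x, q⟩, rfl⟩ := QuotientAddGroup.mk_surjective q
      obtain ⟨⟨h, n⟩, rfl⟩ := QuotientAddGroup.mk_surjective q
      -- Subtracting `n` times the new lattice vector `(a, (0, 1))` moves any point into the copy of
      -- `G × H`.
      refine ⟨((x - n • a, h) : G × S.H), ?_⟩
      rw [QuotientAddGroup.map_mk, QuotientAddGroup.eq_iff_sub_mem, hf, Prod.mk_sub_mk,
        ← QuotientAddGroup.mk_sub, Prod.mk_sub_mk, mk_mem_adjoinLattice]
      convert S.lattice.zero_mem using 1
      simp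
    injOn_fst := by
      rintro ⟨x, q⟩ hq ⟨y, q'⟩ hq' (rfl : x = y)
      have hd := AddSubgroup.sub_mem _ hq hq'
      rw [Prod.mk_sub_mk, sub_self] at hd
      obtain ⟨⟨h, n⟩, hr⟩ := QuotientAddGroup.mk_surjective (q - q')
      -- A lattice vector over `0` is exactly a relation, hence zero in the quotient.
      rw [← hr, mk_mem_adjoinLattice, zero_sub, ← mem_adjoinRelations,
        ← QuotientAddGroup.eq_zero_iff, hr] at hd
      rw [sub_eq_zero.1 hd]
    dense_snd := by
      have hd : Dense ((Prod.snd '' (S.lattice : Set (G × S.H))) ×ˢ (univ : Set ℤ)) :=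
        S.dense_snd.prod dense_univ
      refine (QuotientAddGroup.mk_surjective.denseRange.dense_image
        QuotientAddGroup.continuous_mk hd).mono ?_
      rintro _ ⟨⟨_, n⟩, ⟨⟨⟨x, h⟩, hl, rfl⟩, -⟩, rfl⟩
      refine ⟨(x + n • a, _), ?_, rfl⟩
      exact mk_mem_adjoinLattice.2 (by simpa using hl) }

/-- The homeomorphic copy of the internal space in the coset of the adjoined element. -/
def adjoinMap (S : CutAndProjectScheme G) (a : G) (h : S.H) : (S.adjoin a).H :=
  QuotientAddGroup.mk' (S.adjoinRelations a) (h, 1)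

theorem isOpenEmbedding_adjoinMap (S : CutAndProjectScheme G) (a : G) :
    IsOpenEmbedding (S.adjoinMap a) :=
  .of_continuous_injective_isOpenMap (S.continuous_mk_adjoin a 1) (S.injective_mk_adjoin a 1)
    (S.isOpenMap_mk_adjoin a 1)

theorem projectionSet_adjoinMap (S : CutAndProjectScheme G) (a : G) (W : Set S.H) :
    (S.adjoin a).projectionSet (S.adjoinMap a '' W) = (a + ·) '' S.projectionSet W := by
  ext x
  rw [mem_projectionSet]
  constructor
  · rintro ⟨_, ⟨h, hW, rfl⟩, hl⟩
    have := mk_mem_adjoinLattice.1 hl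
    exact ⟨x - a, mem_projectionSet.2 ⟨h, hW, by simpa using this⟩, by simp⟩
  · rintro ⟨y, hy, rfl⟩
    obtain ⟨h, hW, hl⟩ := mem_projectionSet.1 hy
    exact ⟨_, ⟨h, hW, rfl⟩, mk_mem_adjoinLattice.2 (by simpa using hl)⟩

/-- The embedding of the internal space as an open subgroup. -/
def adjoinHom (S : CutAndProjectScheme G) (a : G) : S.H →+ (S.adjoin a).H :=
  (QuotientAddGroup.mk' (S.adjoinRelations a)).comp (AddMonoidHom.inl S.H ℤ)

/-- Haar measure of the extension restricts to a Haar measure on the open subgroup `H`, and two Haar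
measures are proportional on sets with compact closure. -/
theorem addHaar_adjoinMap_image_eq_zero (S : CutAndProjectScheme G) (a : G) {A : Set S.H}
    (hA : IsCompact A) (h0 : (Measure.addHaar : Measure S.H) A = 0) :
    (Measure.addHaar : Measure (S.adjoin a).H) (S.adjoinMap a '' A) = 0 := by
  have hj : IsOpenEmbedding (S.adjoinHom a) :=
    .of_continuous_injective_isOpenMap (S.continuous_mk_adjoin a 0) (S.injective_mk_adjoin a 0)
      (S.isOpenMap_mk_adjoin a 0)
  have hshift : S.adjoinMap a '' A = (S.adjoinMap a 0 + ·) '' (S.adjoinHom a '' A) := by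
    rw [image_image]
    refine image_congr fun h _ => ?_
    change QuotientAddGroup.mk' (S.adjoinRelations a) _ =
      QuotientAddGroup.mk' (S.adjoinRelations a) _ + QuotientAddGroup.mk' (S.adjoinRelations a) _
    rw [← map_add]
    simp
  rw [hshift, image_add_left, measure_preimage_add, ← hj.measurableEmbedding.comap_apply]
  have : (Measure.comap (S.adjoinHom a) Measure.addHaar).IsAddHaarMeasure :=
    Measure.IsAddHaarMeasure.comap (mH := inferInstance) _ hj
  rw [Measure.measure_isAddInvariant_eq_smul_of_isCompact_closure _ Measure.addHaar hA.closure, h0,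
    smul_zero]

end CutAndProjectScheme

/-! ### Refining the internal space -/

/-- On an uncountable product of circles the Borel sets may exceed the product σ-algebra, so the
Borel structure is named explicitly. -/
theorem Continuous.measurableSet_preimage_borel {X K : Type*} [TopologicalSpace X]
    [MeasurableSpace X] [BorelSpace X] [TopologicalSpace K] {f : X → K} (hf : Continuous f)
    {B : Set K} (hB : MeasurableSet[borel K] B) : MeasurableSet (f ⁻¹' B) := by
  borelize K
  exact hf.measurable hB

namespace CutAndProjectScheme

variable {G : Type u} [AddCommGroup G] [TopologicalSpace G]

/-- The star map together with the evaluation of all rational characters of the lattice. -/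
noncomputable def refineStar (S : CutAndProjectScheme G) :
    S.lattice →+ S.H × (CharacterModule S.lattice → UnitAddCircle) :=
  ((AddMonoidHom.snd G S.H).comp S.lattice.subtype).prod (circleEval S.lattice)

/-- The refined internal space: the closure of the image of the lattice in the product of the
internal space with a compact group. -/
noncomputable abbrev refineSpace (S : CutAndProjectScheme G) :
    AddSubgroup (S.H × (CharacterModule S.lattice → UnitAddCircle)) :=
  S.refineStar.range.topologicalClosure

theorem isClosedEmbedding_refineSpace_subtype (S : CutAndProjectScheme G) :
    IsClosedEmbedding (Subtype.val : S.refineSpace → _) :=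
  S.refineStar.range.isClosed_topologicalClosure.isClosedEmbedding_subtypeVal

/-- The corestriction of `refineStar` to the refined internal space. -/
noncomputable def refineStarCod (S : CutAndProjectScheme G) : S.lattice →+ S.refineSpace :=
  S.refineStar.codRestrict S.refineSpace fun l =>
    S.refineStar.range.le_topologicalClosure ⟨l, rfl⟩

/-- The lattice lifted to the refined internal space. -/
noncomputable def refineLattice (S : CutAndProjectScheme G) : AddSubgroup (G × S.refineSpace) :=
  (((AddMonoidHom.fst G S.H).comp S.lattice.subtype).prod S.refineStarCod).range

/-- The projection of the refined internal space to the original one. -/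
noncomputable def refineFst (S : CutAndProjectScheme G) : S.refineSpace →+ S.H :=
  (AddMonoidHom.fst _ _).comp S.refineSpace.subtype

theorem continuous_refineFst (S : CutAndProjectScheme G) : Continuous S.refineFst :=
  continuous_fst.comp continuous_subtype_val

theorem isCompact_refineFst_preimage (S : CutAndProjectScheme G) {W : Set S.H}
    (hW : IsCompact W) : IsCompact (S.refineFst ⁻¹' W) := by
  convert S.isClosedEmbedding_refineSpace_subtype.isCompact_preimage (hW.prod isCompact_univ)
  ext x
  simp [refineFst]

/-- The range is dense, as it contains the star image of the lattice, and closed, as the discarded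
factor is compact. -/
theorem surjective_refineFst (S : CutAndProjectScheme G) : Function.Surjective S.refineFst := by
  have hclosed : IsClosedMap S.refineFst :=
    isClosedMap_fst_of_compactSpace.comp S.isClosedEmbedding_refineSpace_subtype.isClosedMap
  rw [← range_eq_univ, ← hclosed.isClosed_range.closure_eq]
  refine (S.dense_snd.mono ?_).closure_eq
  rintro _ ⟨l, hl, rfl⟩
  exact ⟨S.refineStarCod ⟨l, hl⟩, rfl⟩

variable [IsTopologicalAddGroup G] [LocallyCompactSpace G]

/-- The refinement of a cut-and-project scheme in which every subset of the lattice is the trace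
of a Borel set of the internal space. -/
noncomputable def refinement (S : CutAndProjectScheme G) : CutAndProjectScheme G where
  H := S.refineSpace
  instLocallyCompactSpace := S.isClosedEmbedding_refineSpace_subtype.locallyCompactSpace
  instMeasurableSpace := borel _
  instBorelSpace := @BorelSpace.mk _ _ (borel _) rfl
  lattice := S.refineLattice
  discrete := by
    obtain ⟨U, hU, V, hV, hUV⟩ := S.exists_nhds_forall_lattice
    have hV' : S.refineFst ⁻¹' V ∈ 𝓝 0 :=
      S.continuous_refineFst.continuousAt.preimage_mem_nhds (by simpa using hV)
    refine discreteTopology_addSubgroup_of_nhds (prod_mem_nhds hU hV') ?_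
    rintro _ ⟨⟨⟨x, h⟩, hl⟩, rfl⟩ ⟨hx, hh⟩
    obtain ⟨rfl, rfl⟩ := hUV x h hl hx hh
    exact map_zero _
  cocompact := by
    have := S.cocompact
    obtain ⟨C, hC, hCl⟩ := exists_isCompact_forall_exists_add_mem S.lattice
    have hC' : IsCompact ((Prod.fst '' C) ×ˢ (S.refineFst ⁻¹' (Prod.snd '' C))) :=
      (hC.image continuous_fst).prod
        (S.isCompact_refineFst_preimage (hC.image continuous_snd))
    refine ⟨(hC'.image (QuotientAddGroup.continuous_mk (N := S.refineLattice))).of_isClosed_subset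
      isClosed_univ fun q _ => ?_⟩
    obtain ⟨⟨x, h⟩, rfl⟩ := QuotientAddGroup.mk_surjective q
    obtain ⟨l, hl, hlC⟩ := hCl (x, S.refineFst h)
    refine ⟨(x, h) + (l.1, S.refineStarCod ⟨l, hl⟩), ⟨⟨_, hlC, rfl⟩, _, hlC, ?_⟩, ?_⟩
    · exact (map_add S.refineFst h (S.refineStarCod ⟨l, hl⟩)).symm
    · rw [QuotientAddGroup.eq_iff_sub_mem, add_sub_cancel_left]
      exact ⟨⟨l, hl⟩, rfl⟩
  injOn_fst := by
    rintro _ ⟨l, rfl⟩ _ ⟨l', rfl⟩ h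
    rw [Subtype.ext (S.injOn_fst l.2 l'.2 h)]
  dense_snd := by
    have : DenseRange S.refineStarCod := by
      intro x
      rw [closure_subtype, ← range_comp]
      exact x.2
    refine this.mono ?_
    rintro _ ⟨l, rfl⟩
    exact ⟨_, ⟨l, rfl⟩, rfl⟩

/-- A set between two projection sets is itself the projection set of a Borel window that lies
between the corresponding windows in the refined scheme. -/
theorem exists_projectionSet_refine_eq (S : CutAndProjectScheme G) {U W : Set S.H}
    (hU : IsOpen U) (hW : IsCompact W) (hUW : U ⊆ W) {Γ : Set G}
    (hUΓ : S.projectionSet U ⊆ Γ) (hΓW : Γ ⊆ S.projectionSet W) :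
    ∃ V : Set S.refinement.H, MeasurableSet V ∧ S.refineFst ⁻¹' U ⊆ V ∧ V ⊆ S.refineFst ⁻¹' W ∧
      Γ = S.refinement.projectionSet V := by
  obtain ⟨B, hB, hBΓ⟩ := exists_borel_preimage_circleEval_eq S.lattice {l | (l : G × S.H).1 ∈ Γ}
  let p : S.refinement.H → S.H := S.refineFst
  have hp : Continuous p := S.continuous_refineFst
  have hsnd : Continuous (fun x : S.refinement.H => (x : S.refineSpace).1.2) :=
    continuous_snd.comp continuous_subtype_val
  have hBiff : ∀ l : S.lattice, (S.refineStarCod l).1.2 ∈ B ↔ (l : G × S.H).1 ∈ Γ := fun l =>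
    Set.ext_iff.1 hBΓ l
  -- Over `U` all lattice points already belong to `Γ`, so only the rest of `W` needs the selection
  -- by `B`.
  refine ⟨p ⁻¹' U ∪ (p ⁻¹' W ∩ (fun x : S.refinement.H => (x : S.refineSpace).1.2) ⁻¹' B), ?_,
    subset_union_left, union_subset (preimage_mono hUW) inter_subset_left, ?_⟩
  · exact (hU.preimage hp).measurableSet.union
      ((hW.isClosed.preimage hp).measurableSet.inter
        (hsnd.measurableSet_preimage_borel hB))
  · ext x
    rw [mem_projectionSet]
    constructor
    · intro hx
      obtain ⟨h, hhW, hl⟩ := mem_projectionSet.1 (hΓW hx)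
      exact ⟨S.refineStarCod ⟨(x, h), hl⟩, Or.inr ⟨hhW, (hBiff ⟨(x, h), hl⟩).2 hx⟩,
        ⟨(x, h), hl⟩, rfl⟩
    · rintro ⟨_, hV, l, hl⟩
      obtain ⟨rfl, rfl⟩ := Prod.mk.inj hl
      rcases hV with hV | ⟨-, hV⟩
      · exact hUΓ (mem_projectionSet.2 ⟨_, hV, l.2⟩)
      · exact (hBiff l).1 hV

/-- The projection is proper and surjective, so it pushes Haar measure to Haar measure. -/
theorem addHaar_refineFst_preimage_eq_zero (S : CutAndProjectScheme G) {A : Set S.H}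
    (hA : IsCompact A) (h0 : (Measure.addHaar : Measure S.H) A = 0) :
    (Measure.addHaar : Measure S.refinement.H) (S.refineFst ⁻¹' A) = 0 := by
  let p : S.refinement.H →+ S.H := S.refineFst
  have hp : Continuous p := S.continuous_refineFst
  have hcoc : Filter.Tendsto p (Filter.cocompact _) (Filter.cocompact _) := by
    refine Filter.hasBasis_cocompact.tendsto_right_iff.2 fun K hK => ?_
    exact (S.isCompact_refineFst_preimage hK).compl_mem_cocompact
  have : (Measure.map p Measure.addHaar).IsAddHaarMeasure :=
    Measure.isAddHaarMeasure_map _ p hp S.surjective_refineFst hcoc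
  have h := Measure.measure_isAddInvariant_eq_smul_of_isCompact_closure
    (Measure.map p Measure.addHaar) Measure.addHaar hA.closure
  rw [h0, smul_zero, Measure.map_apply hp.measurable hA.isClosed.measurableSet] at h
  exact h

end CutAndProjectScheme

/-! ### Equivalence of the three notions -/

section Comparison

variable {G : Type u} [AddCommGroup G] [TopologicalSpace G]

theorem IsModelSet.isInterModelSet {Γ : Set G} (h : IsModelSet Γ) : IsInterModelSet Γ := by
  obtain ⟨S, W, hW, rfl⟩ := h
  exact ⟨S, W, hW, S.projectionSet_mono interior_subset, S.projectionSet_mono subset_closure⟩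

theorem IsRegularModelSet.isInterRegularModelSet {Γ : Set G} (h : IsRegularModelSet Γ) :
    IsInterRegularModelSet Γ := by
  obtain ⟨S, W, hW, rfl⟩ := h
  exact ⟨S, W, hW, S.projectionSet_mono interior_subset, S.projectionSet_mono subset_closure⟩

theorem IsInterModelSet.isAlmostModelSet {Γ : Set G} (h : IsInterModelSet Γ) :
    IsAlmostModelSet Γ := by
  obtain ⟨S, W, hW, h1, h2⟩ := h
  exact ⟨S, interior W, closure W, interior_subset.trans subset_closure, isOpen_interior,
    hW.nonempty_interior, hW.isCompact_closure, h1, h2⟩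

theorem IsInterRegularModelSet.isAlmostRegularModelSet {Γ : Set G}
    (h : IsInterRegularModelSet Γ) : IsAlmostRegularModelSet Γ := by
  obtain ⟨S, W, hW, h1, h2⟩ := h
  exact ⟨S, interior W, closure W, interior_subset.trans subset_closure, isOpen_interior,
    hW.nonempty_interior, hW.isCompact_closure, hW.haar_frontier, h1, h2⟩

variable [IsTopologicalAddGroup G] [LocallyCompactSpace G]

namespace CutAndProjectScheme

/-- A set between the projection sets of an open and a compact window is a model set in the
refined scheme, with a window whose boundary lies over the difference of the two windows. -/
theorem exists_isModelWindow_refine (S : CutAndProjectScheme G) {U W : Set S.H} (hUW : U ⊆ W)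
    (hU : IsOpen U) (hne : U.Nonempty) (hW : IsCompact W) {Γ : Set G}
    (hUΓ : S.projectionSet U ⊆ Γ) (hΓW : Γ ⊆ S.projectionSet W) :
    ∃ V : Set S.refinement.H, S.refinement.IsModelWindow V ∧ frontier V ⊆ S.refineFst ⁻¹' (W \ U) ∧
      Γ = S.refinement.projectionSet V := by
  obtain ⟨V, hVm, hUV, hVW, hΓ⟩ := S.exists_projectionSet_refine_eq hU hW hUW hUΓ hΓW
  have hWc : IsCompact (X := S.refinement.H) (S.refineFst ⁻¹' W) := S.isCompact_refineFst_preimage hW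
  have hUint : S.refineFst ⁻¹' U ⊆ interior V :=
    interior_maximal hUV (hU.preimage S.continuous_refineFst)
  have hclW : closure V ⊆ S.refineFst ⁻¹' W := closure_minimal hVW hWc.isClosed
  refine ⟨V, ⟨hWc.of_isClosed_subset isClosed_closure hclW, hVm, ?_⟩, ?_, hΓ⟩
  · obtain ⟨h, hh⟩ := hne
    obtain ⟨k, rfl⟩ := S.surjective_refineFst h
    exact ⟨k, hUint hh⟩
  · exact fun x hx => ⟨hclW hx.1, fun hxU => hx.2 (hUint hxU)⟩

end CutAndProjectScheme

theorem IsAlmostModelSet.isModelSet {Γ : Set G} (h : IsAlmostModelSet Γ) : IsModelSet Γ := by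
  obtain ⟨S, U, W, hUW, hU, hne, hW, h1, h2⟩ := h
  obtain ⟨V, hV, -, hΓ⟩ := S.exists_isModelWindow_refine hUW hU hne hW h1 h2
  exact ⟨S.refinement, V, hV, hΓ⟩

theorem IsAlmostRegularModelSet.isRegularModelSet {Γ : Set G} (h : IsAlmostRegularModelSet Γ) :
    IsRegularModelSet Γ := by
  obtain ⟨S, U, W, hUW, hU, hne, hW, h0, h1, h2⟩ := h
  obtain ⟨V, hV, hfr, hΓ⟩ := S.exists_isModelWindow_refine hUW hU hne hW h1 h2
  -- Since `U` is open, `W \ U` is compact, as the comparison of Haar measures requires.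
  exact ⟨S.refinement, V, ⟨hV, measure_mono_null hfr
    (S.addHaar_refineFst_preimage_eq_zero (hW.diff hU) h0)⟩, hΓ⟩

end Comparison

/-! ### Passage to the hull -/

section Hull

variable {G : Type u} [AddCommGroup G] [TopologicalSpace G] [IsTopologicalAddGroup G]
  [LocallyCompactSpace G] [T2Space G]

namespace CutAndProjectScheme

/-- An element of the hull of a point set between the projection sets of an open and a compact
window lies between two such projection sets as well, in a scheme obtained by adjoining one
element; the difference of the windows remains a null set if it was one. -/
theorem exists_adjoin_of_mem_hull (S : CutAndProjectScheme G) {U W : Set S.H} (hUW : U ⊆ W)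
    (hU : IsOpen U) (hne : U.Nonempty) (hW : IsCompact W) {Λ Γ : PointSet G}
    (hUΛ : S.projectionSet U ⊆ Λ.carrier) (hΛW : Λ.carrier ⊆ S.projectionSet W)
    (hΓ : Γ ∈ Λ.hull) :
    ∃ (a : G) (U' W' : Set (S.adjoin a).H), U' ⊆ W' ∧ IsOpen U' ∧ U'.Nonempty ∧ IsCompact W' ∧
      ((Measure.addHaar : Measure S.H) (W \ U) = 0 →
        (Measure.addHaar : Measure (S.adjoin a).H) (W' \ U') = 0) ∧
      (S.adjoin a).projectionSet U' ⊆ Γ.carrier ∧ Γ.carrier ⊆ (S.adjoin a).projectionSet W' := by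
  obtain ⟨a, b, h1, h2⟩ := S.exists_translate_of_mem_hull hU hW hUΛ hΛW hΓ
  have hemb := S.isOpenEmbedding_adjoinMap a
  have hcpt : ∀ {A : Set S.H}, IsCompact A → IsCompact ((· + b) ⁻¹' A) := fun hA =>
    (Homeomorph.addRight b).isCompact_preimage.2 hA
  refine ⟨a, S.adjoinMap a '' ((· + b) ⁻¹' U), S.adjoinMap a '' ((· + b) ⁻¹' W),
    image_mono (preimage_mono hUW), ?_, ?_, (hcpt hW).image hemb.continuous, fun h0 => ?_, ?_, ?_⟩
  · exact hemb.isOpenMap _ (hU.preimage (continuous_add_const b))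
  · exact (hne.preimage (add_right_surjective b)).image _
  · rw [← image_sdiff hemb.injective, ← preimage_sdiff]
    exact S.addHaar_adjoinMap_image_eq_zero a (hcpt (hW.diff hU))
      (by rw [measure_preimage_add_right, h0])
  · rwa [projectionSet_adjoinMap]
  · rwa [projectionSet_adjoinMap]

end CutAndProjectScheme

theorem IsAlmostModelSet.of_mem_hull {Λ Γ : PointSet G} (h : IsAlmostModelSet Λ.carrier)
    (hΓ : Γ ∈ Λ.hull) : IsAlmostModelSet Γ.carrier := by
  obtain ⟨S, U, W, hUW, hU, hne, hW, h1, h2⟩ := h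
  obtain ⟨a, U', W', hUW', hU', hne', hW', -, h1', h2'⟩ :=
    S.exists_adjoin_of_mem_hull hUW hU hne hW h1 h2 hΓ
  exact ⟨S.adjoin a, U', W', hUW', hU', hne', hW', h1', h2'⟩

theorem IsAlmostRegularModelSet.of_mem_hull {Λ Γ : PointSet G}
    (h : IsAlmostRegularModelSet Λ.carrier) (hΓ : Γ ∈ Λ.hull) :
    IsAlmostRegularModelSet Γ.carrier := by
  obtain ⟨S, U, W, hUW, hU, hne, hW, h0, h1, h2⟩ := h
  obtain ⟨a, U', W', hUW', hU', hne', hW', h0', h1', h2'⟩ :=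
    S.exists_adjoin_of_mem_hull hUW hU hne hW h1 h2 hΓ
  exact ⟨S.adjoin a, U', W', hUW', hU', hne', hW', h0' h0, h1', h2'⟩

end Hull

theorem mainTheorem5 {G : Type u} [AddCommGroup G] [TopologicalSpace G]
    [IsTopologicalAddGroup G] [LocallyCompactSpace G] [T2Space G]
    (Λ Γ : PointSet G) (hΓ : Γ ∈ Λ.hull) :
    ((IsModelSet Λ.carrier → IsModelSet Γ.carrier) ∧
      (IsRegularModelSet Λ.carrier → IsRegularModelSet Γ.carrier)) ∧
    ((IsInterModelSet Λ.carrier → IsInterModelSet Γ.carrier) ∧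
      (IsInterRegularModelSet Λ.carrier → IsInterRegularModelSet Γ.carrier)) ∧
    ((IsAlmostModelSet Λ.carrier → IsAlmostModelSet Γ.carrier) ∧
      (IsAlmostRegularModelSet Λ.carrier → IsAlmostRegularModelSet Γ.carrier)) := by
  refine ⟨⟨fun h => ?_, fun h => ?_⟩, ⟨fun h => ?_, fun h => ?_⟩, fun h => h.of_mem_hull hΓ,
    fun h => h.of_mem_hull hΓ⟩
  · exact (h.isInterModelSet.isAlmostModelSet.of_mem_hull hΓ).isModelSet
  · exact (h.isInterRegularModelSet.isAlmostRegularModelSet.of_mem_hull hΓ).isRegularModelSet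
  · exact (h.isAlmostModelSet.of_mem_hull hΓ).isModelSet.isInterModelSet
  · exact (h.isAlmostRegularModelSet.of_mem_hull hΓ).isRegularModelSet.isInterRegularModelSet
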